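/- Let $n\ge 2$ and $d\ge 2$ be integers, let $q>0$, and let $m\in\{0,1\}$. Let $X=(X_1,\ldots,X_n)$ have the Dirichlet distribution in which one of the $n$ parameters is equal to $q+m$ and all the others are equal to $q$ (for instance $X\sim\mathcal D(q+m,q,\ldots,q)$). Let $\Theta_1,\ldots,\Theta_n$ be independent random vectors, each uniformly distributed on the unit sphere of a Euclidean space $E_d$ of dimension $d$, with $(\Theta_1,\ldots,\Theta_n)$ independent of $X$, and let $$W_{n,d}=X_1\Theta_1+\cdots+X_n\Theta_n .$$ For a real number $k>d$, a random vector $U$ with values in the closed unit ball of $E_d$ is called hyperuniform of type $k$ if its law is invariant under every orthogonal transformation of $E_d$ and $\|U\|^2\sim\beta\left(\frac d2,\frac{k-d}2\right)$. Then, both for $m=0$ and for $m=1$: 1. if $d\ge 2$ and $q=d-1$, then $W_{n,d}$ is hyperuniform of type $k=n(d-1)+1>d$; in particular $$\|W_{n,d}\|^2\sim\beta\left(\frac d2,\frac{(n-1)(d-1)}2\right);$$ 2. if $d\ge 3$ and $q=\frac d2-1$, then $W_{n,d}$ is hyperuniform of type $k=n(d-2)+2>d$; in particular $$\|W_{n,d}\|^2\sim\beta\left(\frac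 d2,(n-1)\left(\frac d2-1\right)\right).$$ -/

import Mathlib

open MeasureTheory ProbabilityTheory

noncomputable section

/-- The density of the Dirichlet distribution with parameters `q 0, …, q N`, as a function of a
point `y = (y 0, …, y N)` whose coordinates sum to `1`: it equals
`Γ(q 0 + ⋯ + q N) / (Γ(q 0) ⋯ Γ(q N)) * ∏ i, (y i) ^ (q i - 1)` if all the coordinates of `y` are
positive, and `0` otherwise. -/
def dirichletPDFReal {n : ℕ} (q y : Fin n → ℝ) : ℝ :=
  open scoped Classical in
  if ∀ i, 0 < y i then
    Real.Gamma (∑ i, q i) / (∏ i, Real.Gamma (q i)) * ∏ i, (y i) ^ (q i - 1)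
  else 0

/-- The Dirichlet distribution `𝒟(q 0, …, q N)`, as a measure on `ℝ ^ (N + 1)` carried by the
simplex: the last `N` coordinates `x` have the Dirichlet density with respect to Lebesgue measure
on `ℝ ^ N`, and the coordinate of index `0` is `1 - ∑ i, x i`. (There is no Dirichlet distribution
with an empty list of parameters; the value is then `0`.) -/
def dirichletMeasure : {n : ℕ} → (Fin n → ℝ) → Measure (Fin n → ℝ)
  | 0, _ => 0
  | N + 1, q =>
    ((volume : Measure (Fin N → ℝ)).withDensity fun x =>
      ENNReal.ofReal (dirichletPDFReal q (Fin.cons (1 - ∑ i, x i) x))).map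
        fun x => (Fin.cons (1 - ∑ i, x i) x : Fin (N + 1) → ℝ)

section

variable (E : Type*) [NormedAddCommGroup E] [InnerProductSpace ℝ E] [FiniteDimensional ℝ E]
  [MeasurableSpace E] [BorelSpace E]

/-- The uniform distribution on the unit sphere of the Euclidean space `E` (the normalized surface
measure), seen as a measure on `E`. -/
def sphereUniform : Measure E :=
  (((volume : Measure E).toSphere Set.univ)⁻¹ • (volume : Measure E).toSphere).map Subtype.val

end

section

variable {Ω E : Type*} [NormedAddCommGroup E] [InnerProductSpace ℝ E]

/-- The random vector `X₁ Θ₁ + ⋯ + Xₙ Θₙ`. -/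
def randomWalk {n : ℕ} (X : Ω → Fin n → ℝ) (Θ : Fin n → Ω → E) (ω : Ω) : E :=
  ∑ j, X ω j • Θ j ω

/-- The random vector `U` of the Euclidean space `E` of dimension `d` is hyperuniform of type `k`,
where `k > d` is a real number: `U` is valued in the closed unit ball, its law is invariant under
the orthogonal group, and `‖U‖²` follows the beta distribution `β(d / 2, (k - d) / 2)`. -/
structure IsHyperuniform [MeasurableSpace E] [MeasurableSpace Ω]
    (U : Ω → E) (k : ℝ) (P : Measure Ω) : Prop where
  aemeasurable : AEMeasurable U P
  finrank_lt : (Module.finrank ℝ E : ℝ) < k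
  norm_le_one : ∀ᵐ ω ∂P, ‖U ω‖ ≤ 1
  invariant : ∀ a : E ≃ₗᵢ[ℝ] E, IdentDistrib (fun ω => a (U ω)) U P P
  hasLaw_norm_sq : HasLaw (fun ω => ‖U ω‖ ^ 2)
    (betaMeasure ((Module.finrank ℝ E : ℝ) / 2) ((k - Module.finrank ℝ E) / 2)) P

end

end

/-! Everything reduces to the even moments of `⟨e, W⟩` for a unit vector `e`. Expand `⟨e, ∑ Xᵢ Θᵢ⟩ ^
(2j)` by the multinomial theorem. Dirichlet moments are quotients of rising factorials; the odd
moments of `⟨e, Θ⟩` vanish and the even ones are `(1/2)_j / (d/2)_j`. Hence `E⟨e, W⟩ ^ (2j)` is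
`(2j)! / (Q)_{2j}` times the coefficient of `z ^ j` in `∏ F_{qᵢ}`, where `Q = ∑ qᵢ` and `F_q =
₂F₁(q/2, (q+1)/2; d/2; z)` (`integral_dirichletWalkMeasure_inner_pow`).

Averaging over `e` turns these into moments of `‖W‖²`. They are the beta moments `(d/2)_j / (k/2)_j`
as soon as `∏ F_{qᵢ} = ₂F₁(Q/2, (Q+1)/2; k/2; z)`, and moments determine a law on `[0, 1]`
(`isHyperuniform_randomWalk`). Rotation invariance is inherited from the `Θᵢ`.

The product identity holds because the series are elementary in both cases. If `d/2 = (q+1)/2`, they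
are powers of `1 - z`. If `d/2 = q + 1`, they are powers of `2 / (1 + √(1 - z))`, with an extra
factor `(1 - z) ^ (-1/2)` for the parameter `q + 1`. Both families are handled formally, through
differential equations for power series. -/

noncomputable section

/-! ### Dirichlet integrals and Dirichlet moments -/

lemma Real.Gamma_add_natCast_eq {x : ℝ} (hx : 0 < x) (n : ℕ) :
    Real.Gamma (x + n) = (ascPochhammer ℝ n).eval x * Real.Gamma x := by
  induction n with
  | zero => simp
  | succ n ih =>
    rw [ascPochhammer_succ_eval, Nat.cast_succ, ← add_assoc, Real.Gamma_add_one (by positivity), ih]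
    ring

/-- The function `y ↦ y ^ (a - 1)` on the positive half-line, extended by `0`. -/
def powerDensity (a y : ℝ) : ENNReal := ENNReal.ofReal (if 0 < y then y ^ (a - 1) else 0)

@[fun_prop]
lemma measurable_powerDensity (a : ℝ) : Measurable (powerDensity a) := by
  unfold powerDensity
  exact (Measurable.ite measurableSet_Ioi (by fun_prop) (by fun_prop)).ennreal_ofReal

lemma powerDensity_of_pos {a y : ℝ} (hy : 0 < y) :
    powerDensity a y = ENNReal.ofReal (y ^ (a - 1)) := by simp [powerDensity, hy]

lemma powerDensity_of_nonpos {a y : ℝ} (hy : y ≤ 0) : powerDensity a y = 0 := by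
  simp [powerDensity, hy.not_gt]

lemma lintegral_powerDensity_one_sub {a b : ℝ} (ha : 0 < a) (hb : 0 < b) :
    ∫⁻ x, powerDensity a (1 - x) * powerDensity b x = ENNReal.ofReal (beta a b) := by
  have hB := beta_pos hb ha
  have h : ∀ x, powerDensity a (1 - x) * powerDensity b x
      = ENNReal.ofReal (beta b a) * betaPDF b a x := by
    intro x
    rcases le_or_gt x 0 with h0 | h0
    · rw [betaPDF_eq_zero_of_nonpos h0, powerDensity_of_nonpos h0]; simp
    rcases le_or_gt 1 x with h1 | h1
    · rw [betaPDF_eq_zero_of_one_le h1, powerDensity_of_nonpos (a := a) (by linarith)]; simp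
    rw [betaPDF_of_pos_lt_one h0 h1, powerDensity_of_pos h0, powerDensity_of_pos (by linarith),
      ← ENNReal.ofReal_mul (Real.rpow_nonneg (by linarith) _), ← ENNReal.ofReal_mul hB.le]
    congr 1
    field_simp
  simp_rw [h]
  rw [lintegral_const_mul' _ _ ENNReal.ofReal_ne_top,
    lintegral_betaPDF_eq_one hb ha, mul_one]
  congr 1
  unfold beta
  rw [add_comm a b, mul_comm]

lemma powerDensity_mul {a s : ℝ} (hs : 0 < s) (y : ℝ) :
    powerDensity a (s * y) = ENNReal.ofReal (s ^ (a - 1)) * powerDensity a y := by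
  rcases le_or_gt y 0 with hy | hy
  · rw [powerDensity_of_nonpos hy, powerDensity_of_nonpos (mul_nonpos_of_nonneg_of_nonpos hs.le hy),
      mul_zero]
  · rw [powerDensity_of_pos hy, powerDensity_of_pos (mul_pos hs hy),
      Real.mul_rpow hs.le hy.le, ENNReal.ofReal_mul (by positivity)]

/-- The substitution `x ↦ s * x` reduces this convolution to the beta integral on `[0, 1]`. A
general `s` is needed because the induction for the Dirichlet integral replaces `s` by `s - x`. -/
lemma lintegral_powerDensity_sub {a b : ℝ} (ha : 0 < a) (hb : 0 < b) (s : ℝ) :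
    ∫⁻ x, powerDensity a (s - x) * powerDensity b x
      = ENNReal.ofReal (beta a b) * powerDensity (a + b) s := by
  rcases le_or_gt s 0 with hs | hs
  · rw [powerDensity_of_nonpos hs, mul_zero]
    refine lintegral_eq_zero_of_ae_eq_zero (.of_forall fun x => ?_)
    rcases le_or_gt x 0 with h0 | h0
    · simp [powerDensity_of_nonpos h0]
    · simp [powerDensity_of_nonpos (a := a) (show s - x ≤ 0 by linarith)]
  rw [← Real.smul_map_volume_mul_left hs.ne', lintegral_smul_measure,
    lintegral_map (by fun_prop) (by fun_prop)]
  have h : ∀ x, powerDensity a (s - s * x) * powerDensity b (s * x)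
      = ENNReal.ofReal (s ^ (a - 1) * s ^ (b - 1)) *
        (powerDensity a (1 - x) * powerDensity b x) := by
    intro x
    rw [show s - s * x = s * (1 - x) by ring, powerDensity_mul hs, powerDensity_mul hs,
      ENNReal.ofReal_mul (by positivity)]
    ring
  simp_rw [h]
  have hB := beta_pos ha hb
  rw [lintegral_const_mul' _ _ ENNReal.ofReal_ne_top, lintegral_powerDensity_one_sub ha hb,
    powerDensity_of_pos hs, smul_eq_mul, abs_of_pos hs, ← ENNReal.ofReal_mul (by positivity),
    ← ENNReal.ofReal_mul (by positivity), ← ENNReal.ofReal_mul (by positivity)]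
  congr 1
  rw [show a + b - 1 = 1 + (a - 1) + (b - 1) by ring, Real.rpow_add hs, Real.rpow_add hs,
    Real.rpow_one]
  ring

/-- The Dirichlet integral. -/
lemma lintegral_powerDensity_sub_sum {N : ℕ} {a : ℝ} (ha : 0 < a) {b : Fin N → ℝ}
    (hb : ∀ i, 0 < b i) (s : ℝ) :
    ∫⁻ x : Fin N → ℝ, powerDensity a (s - ∑ i, x i) * ∏ i, powerDensity (b i) (x i)
      = ENNReal.ofReal (Real.Gamma a * (∏ i, Real.Gamma (b i)) / Real.Gamma (a + ∑ i, b i)) *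
        powerDensity (a + ∑ i, b i) s := by
  induction N generalizing s with
  | zero => simp [lintegral_unique, (Real.Gamma_pos_of_pos ha).ne', volume_pi]
  | succ N ih =>
    rw [← ((volume_preserving_piFinSuccAbove (fun _ : Fin (N + 1) => ℝ) 0).symm).lintegral_comp_emb
      (MeasurableEquiv.measurableEmbedding _), Measure.volume_eq_prod, lintegral_prod]
    · have hsum : 0 < a + ∑ i : Fin N, b i.succ :=
        add_pos_of_pos_of_nonneg ha (Finset.sum_nonneg fun i _ => (hb _).le)
      have h : ∀ x : ℝ, ∫⁻ y : Fin N → ℝ, powerDensity a (s - ∑ i,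
            ((MeasurableEquiv.piFinSuccAbove (fun _ : Fin (N + 1) => ℝ) 0).symm (x, y)) i) *
            ∏ i, powerDensity (b i)
              (((MeasurableEquiv.piFinSuccAbove (fun _ : Fin (N + 1) => ℝ) 0).symm (x, y)) i)
          = ENNReal.ofReal (Real.Gamma a * (∏ i : Fin N, Real.Gamma (b i.succ)) /
              Real.Gamma (a + ∑ i : Fin N, b i.succ)) *
            (powerDensity (a + ∑ i : Fin N, b i.succ) (s - x) * powerDensity (b 0) x) := by
        intro x
        have h' : ∀ y : Fin N → ℝ, powerDensity a (s - ∑ i,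
            ((MeasurableEquiv.piFinSuccAbove (fun _ : Fin (N + 1) => ℝ) 0).symm (x, y)) i) *
            ∏ i, powerDensity (b i)
              (((MeasurableEquiv.piFinSuccAbove (fun _ : Fin (N + 1) => ℝ) 0).symm (x, y)) i)
            = powerDensity (b 0) x * (powerDensity a ((s - x) - ∑ i, y i) *
              ∏ i : Fin N, powerDensity (b i.succ) (y i)) := by
          intro y
          simp only [MeasurableEquiv.piFinSuccAbove_symm_apply, Fin.insertNthEquiv_zero,
            Fin.consEquiv_apply, Fin.sum_univ_succ, Fin.prod_univ_succ, Fin.cons_zero,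
            Fin.cons_succ]
          rw [sub_add_eq_sub_sub]
          ring
        simp_rw [h']
        rw [lintegral_const_mul' _ _ (by simp [powerDensity]), ih (fun i => hb i.succ)]
        ring
      simp_rw [h]
      rw [lintegral_const_mul' _ _ ENNReal.ofReal_ne_top, lintegral_powerDensity_sub hsum (hb 0),
        ← mul_assoc, ← ENNReal.ofReal_mul]
      · have hG := Real.Gamma_pos_of_pos hsum
        rw [Fin.sum_univ_succ, Fin.prod_univ_succ, beta,
          show a + ∑ i : Fin N, b i.succ + b 0 = a + (b 0 + ∑ i : Fin N, b i.succ) by ring]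
        congr 2
        field_simp
      · have h1 := Real.Gamma_pos_of_pos ha
        have h2 := Real.Gamma_pos_of_pos hsum
        have h3 : ∀ i : Fin N, 0 < Real.Gamma (b i.succ) := fun i => Real.Gamma_pos_of_pos (hb _)
        have h4 := Finset.prod_pos fun i (_ : i ∈ Finset.univ) => h3 i
        positivity
    · exact Measurable.aemeasurable (by fun_prop)

/-- A monomial only shifts the exponents of the density. Off the open orthant both sides vanish,
whatever the sign of the monomial. -/
lemma ofReal_dirichletPDFReal_mul_prod_pow {n : ℕ} {q : Fin n → ℝ} (hq : ∀ i, 0 < q i)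
    (α : Fin n → ℕ) (y : Fin n → ℝ) :
    ENNReal.ofReal (dirichletPDFReal q y) * ENNReal.ofReal (∏ i, y i ^ α i) =
      ENNReal.ofReal (Real.Gamma (∑ i, q i) / ∏ i, Real.Gamma (q i)) *
        ∏ i, powerDensity (q i + α i) (y i) := by
  unfold dirichletPDFReal
  split_ifs with h
  · have hc : 0 ≤ Real.Gamma (∑ i, q i) / ∏ i, Real.Gamma (q i) :=
      div_nonneg (Real.Gamma_nonneg_of_nonneg (Finset.sum_nonneg fun i _ => (hq i).le))
        (Finset.prod_nonneg fun i _ => (Real.Gamma_pos_of_pos (hq i)).le)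
    have hp : 0 ≤ ∏ i, y i ^ (q i - 1) :=
      Finset.prod_nonneg fun i _ => Real.rpow_nonneg (h i).le _
    rw [ENNReal.ofReal_mul hc, mul_assoc, ← ENNReal.ofReal_mul hp, ← Finset.prod_mul_distrib,
      ENNReal.ofReal_prod_of_nonneg fun i _ =>
        mul_nonneg (Real.rpow_nonneg (h i).le _) (pow_nonneg (h i).le _)]
    congr 1
    refine Finset.prod_congr rfl fun i _ => ?_
    rw [powerDensity_of_pos (h i), ← Real.rpow_natCast, ← Real.rpow_add (h i)]
    ring_nf
  · push Not at h
    obtain ⟨i, hi⟩ := h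
    rw [Finset.prod_eq_zero (f := fun i => powerDensity _ _) (Finset.mem_univ i)
      (powerDensity_of_nonpos hi)]
    simp

lemma measurable_simplex_cons (N : ℕ) : Measurable
    fun x : Fin N → ℝ => (Fin.cons (1 - ∑ i, x i) x : Fin (N + 1) → ℝ) := by
  refine measurable_pi_lambda _ fun i => ?_
  refine Fin.cases ?_ (fun j => ?_) i
  · simp only [Fin.cons_zero]; fun_prop
  · simp only [Fin.cons_succ]; fun_prop

lemma measurable_dirichletPDFReal {n : ℕ} (q : Fin n → ℝ) : Measurable (dirichletPDFReal q) := by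
  unfold dirichletPDFReal
  refine Measurable.ite ?_ (by fun_prop) (by fun_prop)
  rw [show {y : Fin n → ℝ | ∀ i, 0 < y i} = ⋂ i, {y | 0 < y i} by ext; simp]
  exact MeasurableSet.iInter fun i => measurableSet_lt measurable_const (measurable_pi_apply i)

lemma measurable_dirichletPDFReal_cons {N : ℕ} (q : Fin (N + 1) → ℝ) :
    Measurable fun x : Fin N → ℝ =>
      ENNReal.ofReal (dirichletPDFReal q (Fin.cons (1 - ∑ i, x i) x)) :=
  ((measurable_dirichletPDFReal q).comp (measurable_simplex_cons N)).ennreal_ofReal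

/-- This is the Dirichlet integral with parameters `q i + α i`, divided by the normalizing one with
parameters `q i`; the quotients of Gamma values are rising factorials. -/
lemma lintegral_dirichletMeasure_prod_pow {N : ℕ} {q : Fin (N + 1) → ℝ} (hq : ∀ i, 0 < q i)
    (α : Fin (N + 1) → ℕ) :
    ∫⁻ y, ENNReal.ofReal (∏ i, y i ^ α i) ∂(dirichletMeasure q) =
      ENNReal.ofReal ((∏ i, (ascPochhammer ℝ (α i)).eval (q i)) /
        (ascPochhammer ℝ (∑ i, α i)).eval (∑ i, q i)) := by
  have hQ : 0 < ∑ i, q i := Finset.sum_pos (fun i _ => hq i) Finset.univ_nonempty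
  have hc : 0 ≤ Real.Gamma (∑ i, q i) / ∏ i, Real.Gamma (q i) :=
      div_nonneg (Real.Gamma_nonneg_of_nonneg hQ.le)
        (Finset.prod_nonneg fun i _ => (Real.Gamma_pos_of_pos (hq i)).le)
  rw [dirichletMeasure, lintegral_map (by fun_prop) (measurable_simplex_cons N),
    lintegral_withDensity_eq_lintegral_mul _ (measurable_dirichletPDFReal_cons q)
      (g := fun x => ENNReal.ofReal
        (∏ i, (Fin.cons (1 - ∑ i, x i) x : Fin (N + 1) → ℝ) i ^ α i))
      (Measurable.comp (g := fun y : Fin (N + 1) → ℝ => ENNReal.ofReal (∏ i, y i ^ α i))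
        (by fun_prop) (measurable_simplex_cons N))]
  simp only [Pi.mul_apply]
  simp_rw [ofReal_dirichletPDFReal_mul_prod_pow hq]
  rw [lintegral_const_mul' _ _ ENNReal.ofReal_ne_top]
  simp_rw [Fin.prod_univ_succ (fun i => powerDensity _ _), Fin.cons_zero, Fin.cons_succ]
  rw [lintegral_powerDensity_sub_sum (add_pos_of_pos_of_nonneg (hq 0) (by positivity))
    (fun i => add_pos_of_pos_of_nonneg (hq _) (by positivity)), powerDensity_of_pos one_pos,
    Real.one_rpow, ENNReal.ofReal_one, mul_one, ← ENNReal.ofReal_mul hc]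
  congr 1
  rw [← Fin.prod_univ_succ (fun i => Real.Gamma (q i + α i)),
    ← Fin.sum_univ_succ (fun i => q i + (α i : ℝ)), Finset.sum_add_distrib, ← Nat.cast_sum,
    Real.Gamma_add_natCast_eq hQ]
  simp_rw [Real.Gamma_add_natCast_eq (hq _)]
  rw [Finset.prod_mul_distrib]
  have h1 := (Real.Gamma_pos_of_pos hQ).ne'
  have h2 : ∏ i, Real.Gamma (q i) ≠ 0 :=
    Finset.prod_ne_zero_iff.2 fun i _ => (Real.Gamma_pos_of_pos (hq i)).ne'
  have h3 := (ascPochhammer_pos (∑ i, α i) _ hQ).ne'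
  field_simp

lemma isProbabilityMeasure_dirichletMeasure {N : ℕ} {q : Fin (N + 1) → ℝ} (hq : ∀ i, 0 < q i) :
    IsProbabilityMeasure (dirichletMeasure q) := by
  have := lintegral_dirichletMeasure_prod_pow hq 0
  exact ⟨by simpa using this⟩

lemma ae_dirichletMeasure {N : ℕ} (q : Fin (N + 1) → ℝ) :
    ∀ᵐ y ∂(dirichletMeasure q), (∀ i, 0 < y i) ∧ ∑ i, y i = 1 := by
  have hm : MeasurableSet {y : Fin (N + 1) → ℝ | (∀ i, 0 < y i) ∧ ∑ i, y i = 1} := by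
    rw [show {y : Fin (N + 1) → ℝ | (∀ i, 0 < y i) ∧ ∑ i, y i = 1}
      = (⋂ i, {y | 0 < y i}) ∩ {y | ∑ i, y i = 1} by ext; simp]
    exact (MeasurableSet.iInter fun i =>
      measurableSet_lt measurable_const (measurable_pi_apply i)).inter
      (measurableSet_eq_fun (by fun_prop) measurable_const)
  rw [dirichletMeasure, ae_map_iff (measurable_simplex_cons N).aemeasurable hm,
    ae_withDensity_iff (measurable_dirichletPDFReal_cons q)]
  refine .of_forall fun x hx => ⟨?_, by simp [Fin.sum_univ_succ]⟩
  by_contra h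
  exact hx (by simp [dirichletPDFReal, h])

lemma integral_dirichletMeasure_prod_pow {N : ℕ} {q : Fin (N + 1) → ℝ} (hq : ∀ i, 0 < q i)
    (α : Fin (N + 1) → ℕ) :
    ∫ y, ∏ i, y i ^ α i ∂(dirichletMeasure q) =
      (∏ i, (ascPochhammer ℝ (α i)).eval (q i)) /
        (ascPochhammer ℝ (∑ i, α i)).eval (∑ i, q i) := by
  rw [integral_eq_lintegral_of_nonneg_ae, lintegral_dirichletMeasure_prod_pow hq,
    ENNReal.toReal_ofReal]
  · exact div_nonneg (Finset.prod_nonneg fun i _ => (ascPochhammer_pos _ _ (hq i)).le)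
      (ascPochhammer_pos _ _ (Finset.sum_pos (fun i _ => hq i) Finset.univ_nonempty)).le
  · filter_upwards [ae_dirichletMeasure q] with y hy
    exact Finset.prod_nonneg fun i _ => pow_nonneg (hy.1 i).le _
  · exact Measurable.aestronglyMeasurable (by fun_prop)

/-! ### Invariance and moments of the uniform law on the sphere -/

lemma integral_Ioi_pow_mul_exp_neg_sq (n : ℕ) :
    ∫ r in Set.Ioi (0 : ℝ), r ^ n * Real.exp (-r ^ 2) = Real.Gamma ((n + 1) / 2) / 2 := by
  have h := integral_rpow_mul_exp_neg_rpow (p := 2) (q := n) (by norm_num)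
    (by linarith [n.cast_nonneg (α := ℝ)])
  simp only [Real.rpow_natCast, Real.rpow_ofNat] at h
  rw [h]; ring

lemma integral_pow_mul_exp_neg_sq (j : ℕ) :
    ∫ x : ℝ, x ^ (2 * j) * Real.exp (-x ^ 2) = Real.Gamma (j + 1 / 2) := by
  have h := integral_comp_abs (f := fun x : ℝ => x ^ (2 * j) * Real.exp (-x ^ 2))
  simp only [pow_mul, sq_abs] at h ⊢
  rw [h]
  have := integral_Ioi_pow_mul_exp_neg_sq (2 * j)
  simp only [pow_mul] at this
  rw [this]
  push_cast
  ring_nf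

section

variable {E : Type*} [NormedAddCommGroup E] [InnerProductSpace ℝ E] [FiniteDimensional ℝ E]
  [MeasurableSpace E] [BorelSpace E]

lemma isProbabilityMeasure_sphereUniform [Nontrivial E] :
    IsProbabilityMeasure (sphereUniform E) := by
  refine ⟨?_⟩
  rw [sphereUniform, Measure.map_apply measurable_subtype_coe .univ, Set.preimage_univ,
    Measure.smul_apply, smul_eq_mul, ENNReal.inv_mul_cancel _ (measure_ne_top _ _)]
  exact fun h => (volume : Measure E).toSphere_ne_zero (Measure.measure_univ_eq_zero.1 h)

lemma ae_sphereUniform_norm_eq_one : ∀ᵐ θ ∂(sphereUniform E), ‖θ‖ = 1 := by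
  rw [sphereUniform, ae_map_iff measurable_subtype_coe.aemeasurable
    (measurableSet_eq_fun (by fun_prop) measurable_const)]
  exact .of_forall fun x => by simp

-- Up to a dimensional factor, the surface measure of a set is the volume of the cone over it. A
-- linear isometry preserves volume and commutes with taking cones.
open scoped Pointwise in
lemma measurePreserving_sphereUniform (a : E ≃ₗᵢ[ℝ] E) :
    MeasurePreserving a (sphereUniform E) (sphereUniform E) := by
  refine ⟨a.continuous.measurable, ?_⟩
  let φ : Metric.sphere (0 : E) 1 → Metric.sphere (0 : E) 1 := fun x => ⟨a x, by simp⟩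
  have hφ : Measurable φ := (a.continuous.measurable.comp measurable_subtype_coe).subtype_mk
  have hmap : (volume : Measure E).toSphere.map φ = (volume : Measure E).toSphere := by
    ext s hs
    rw [Measure.map_apply hφ hs, Measure.toSphere_apply' _ hs, Measure.toSphere_apply' _ (hφ hs)]
    congr 1
    rw [← a.measurePreserving.measure_preimage_emb a.toHomeomorph.measurableEmbedding
      (Set.Ioo (0 : ℝ) 1 • (Subtype.val '' s))]
    congr 2
    ext x
    simp only [Set.mem_preimage, Set.mem_smul, Set.mem_image]
    constructor
    · rintro ⟨r, hr, _, ⟨y, hy, rfl⟩, rfl⟩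
      exact ⟨r, hr, _, ⟨φ y, hy, rfl⟩, by simp [φ]⟩
    · rintro ⟨r, hr, _, ⟨y, hy, rfl⟩, h⟩
      refine ⟨r, hr, _, ⟨⟨a.symm y, by simp⟩, ?_, rfl⟩, ?_⟩
      · simpa [φ] using hy
      · apply a.injective
        simpa using h
  rw [sphereUniform, Measure.map_map a.continuous.measurable measurable_subtype_coe,
    show (a : E → E) ∘ Subtype.val = Subtype.val ∘ φ from rfl,
    ← Measure.map_map measurable_subtype_coe hφ, Measure.map_smul, hmap]

lemma integral_sphereUniform (f : E → ℝ) (hf : Measurable f) :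
    ∫ θ, f θ ∂(sphereUniform E) =
      ((volume : Measure E).toSphere.real Set.univ)⁻¹ *
        ∫ θ, f θ.1 ∂(volume : Measure E).toSphere := by
  rw [sphereUniform, integral_map measurable_subtype_coe.aemeasurable
    hf.aestronglyMeasurable, integral_smul_measure, ENNReal.toReal_inv]
  rfl

/-- Integration in polar coordinates of a homogeneous function against a radial one. -/
lemma integral_mul_norm_eq_integral_toSphere_mul [Nontrivial E] (f : E → ℝ) (g : ℝ → ℝ) (n : ℕ)
    (hf : ∀ (r : ℝ) (x : E), 0 < r → f (r • x) = r ^ n * f x) :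
    ∫ x : E, f x * g ‖x‖ = (∫ θ, f θ.1 ∂(volume : Measure E).toSphere) *
      ∫ r in Set.Ioi (0 : ℝ), r ^ (n + (Module.finrank ℝ E - 1)) * g r := by
  calc ∫ x : E, f x * g ‖x‖
      = ∫ x : ({(0)}ᶜ : Set E), f x.1 * g ‖x.1‖ ∂((volume : Measure E).comap (↑)) := by
        rw [integral_subtype_comap (measurableSet_singleton _).compl fun x ↦ f x * g ‖x‖,
          restrict_compl_singleton]
    _ = ∫ p, f p.1.1 * (p.2.1 ^ n * g p.2.1) ∂(volume : Measure E).toSphere.prod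
          (.volumeIoiPow (Module.finrank ℝ E - 1)) := by
        rw [← (volume : Measure E).measurePreserving_homeomorphUnitSphereProd.integral_comp
          (Homeomorph.measurableEmbedding _)]
        congr 1 with x
        have hx : 0 < ‖x.1‖ := norm_pos_iff.2 x.2
        simp only [homeomorphUnitSphereProd_apply_fst_coe, homeomorphUnitSphereProd_apply_snd_coe]
        rw [hf _ _ (inv_pos.2 hx), inv_pow]
        field_simp
    _ = (∫ θ, f θ.1 ∂(volume : Measure E).toSphere) *
          ∫ r : Set.Ioi (0 : ℝ), r.1 ^ n * g r.1 ∂.volumeIoiPow (Module.finrank ℝ E - 1) :=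
        integral_prod_mul (fun θ : Metric.sphere (0 : E) 1 => f θ.1)
          (fun r : Set.Ioi (0 : ℝ) => r.1 ^ n * g r.1)
    _ = _ := by
        congr 1
        simp only [Measure.volumeIoiPow, ENNReal.ofReal]
        rw [integral_withDensity_eq_integral_smul,
          integral_subtype_comap measurableSet_Ioi
            fun a ↦ Real.toNNReal (a ^ (Module.finrank ℝ E - 1)) • (a ^ n * g a),
          setIntegral_congr_fun measurableSet_Ioi fun x hx ↦ ?_]
        · rw [NNReal.smul_def, Real.coe_toNNReal _ (pow_nonneg hx.out.le _), smul_eq_mul]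
          ring
        · exact (measurable_subtype_coe.pow_const _).real_toNNReal

/-- In the coordinates of `b` the integrand is a product of one-variable Gaussian factors, only the
one of index `0` carrying a power. -/
lemma integral_inner_pow_mul_exp_neg_norm_sq {d : ℕ} (b : OrthonormalBasis (Fin (d + 1)) ℝ E)
    (j : ℕ) : ∫ x : E, inner ℝ (b 0) x ^ (2 * j) * Real.exp (-‖x‖ ^ 2) =
      Real.Gamma (j + 1 / 2) * Real.Gamma (1 / 2) ^ d := by
  have h : ∀ x : E, inner ℝ (b 0) x ^ (2 * j) * Real.exp (-‖x‖ ^ 2) =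
      (fun y : Fin (d + 1) → ℝ => ∏ i, (y i ^ (2 * (if i = 0 then j else 0)) *
        Real.exp (-y i ^ 2))) (WithLp.ofLp (b.repr x)) := by
    intro x
    simp only
    rw [Finset.prod_mul_distrib, ← Real.exp_sum, Finset.sum_neg_distrib,
      Finset.prod_eq_single_of_mem (0 : Fin (d + 1)) (Finset.mem_univ _) (by simp +contextual),
      if_pos rfl, b.repr_apply_apply, ← b.repr.norm_map x, EuclideanSpace.real_norm_sq_eq]
  simp_rw [h]
  rw [b.measurePreserving_repr.integral_comp b.repr.toHomeomorph.measurableEmbedding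
    (fun z : EuclideanSpace ℝ (Fin (d + 1)) =>
      ∏ i, ((WithLp.ofLp z) i ^ (2 * (if i = 0 then j else 0)) * Real.exp (-(WithLp.ofLp z) i ^ 2))),
    (PiLp.volume_preserving_ofLp (Fin (d + 1))).integral_comp
      (MeasurableEquiv.toLp 2 (Fin (d + 1) → ℝ)).symm.measurableEmbedding
      (fun y : Fin (d + 1) → ℝ => ∏ i, (y i ^ (2 * (if i = 0 then j else 0)) *
        Real.exp (-y i ^ 2))),
    integral_fintype_prod_volume_eq_prod
      (fun (i : Fin (d + 1)) (y : ℝ) => y ^ (2 * (if i = 0 then j else 0)) * Real.exp (-y ^ 2))]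
  simp_rw [integral_pow_mul_exp_neg_sq]
  rw [Fin.prod_univ_succ]
  simp [Fin.succ_ne_zero]

/-- The Gaussian integral of `⟨e, x⟩ ^ (2j)` is computed both in polar and in Cartesian coordinates,
in a basis containing `e`; comparing the two isolates the spherical integral. -/
lemma integral_sphereUniform_inner_pow_even [Nontrivial E] {e : E} (he : ‖e‖ = 1) (j : ℕ) :
    ∫ θ, inner ℝ e θ ^ (2 * j) ∂(sphereUniform E) =
      (ascPochhammer ℝ j).eval (1 / 2) /
        (ascPochhammer ℝ j).eval ((Module.finrank ℝ E : ℝ) / 2) := by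
  obtain ⟨d, hd⟩ : ∃ d, Module.finrank ℝ E = d + 1 :=
    Nat.exists_eq_succ_of_ne_zero Module.finrank_pos.ne'
  obtain ⟨b, hb⟩ := Orthonormal.exists_orthonormalBasis_extension_of_card_eq (𝕜 := ℝ) (E := E)
    (ι := Fin (d + 1)) (by simpa using hd) (v := fun _ => e) (s := {0})
    ⟨by simpa using he, fun i j hij => absurd (Subsingleton.elim i j) hij⟩
  obtain rfl : b 0 = e := hb 0 rfl
  have key : ∀ j : ℕ, (∫ θ, inner ℝ (b 0) θ.1 ^ (2 * j) ∂(volume : Measure E).toSphere) *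
      (Real.Gamma (j + (d + 1 : ℝ) / 2) / 2) = Real.Gamma (j + 1 / 2) * Real.Gamma (1 / 2) ^ d := by
    intro j
    rw [← integral_inner_pow_mul_exp_neg_norm_sq b j,
      integral_mul_norm_eq_integral_toSphere_mul (fun x : E => inner ℝ (b 0) x ^ (2 * j))
        (fun r => Real.exp (-r ^ 2)) (2 * j) (fun r x _ => by rw [inner_smul_right, mul_pow]),
      integral_Ioi_pow_mul_exp_neg_sq, hd]
    congr 3
    push_cast
    ring
  -- The case `j = 0` gives the total area of the sphere, by which `kj` is then normalized.
  have k0 := key 0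
  have kj := key j
  have hd2 : (0 : ℝ) < (d + 1 : ℝ) / 2 := by positivity
  rw [add_comm (j : ℝ), Real.Gamma_add_natCast_eq hd2, add_comm (j : ℝ),
    Real.Gamma_add_natCast_eq (by norm_num)] at kj
  simp only [Nat.cast_zero, zero_add, mul_zero, pow_zero, integral_const, smul_eq_mul,
    mul_one] at k0
  rw [integral_sphereUniform _ (by fun_prop), hd]
  push_cast
  have h1 := (Real.Gamma_pos_of_pos hd2).ne'
  have h2 := (Real.Gamma_pos_of_pos (s := 1 / 2) (by norm_num)).ne'
  have h3 := (ascPochhammer_pos j _ hd2).ne'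
  have h4 : (volume : Measure E).toSphere.real Set.univ ≠ 0 := by
    intro h
    rw [h, zero_mul] at k0
    exact mul_ne_zero h2 (pow_ne_zero _ h2) k0.symm
  rw [inv_mul_eq_div, div_eq_div_iff h4 h3]
  have : Real.Gamma ((d + 1 : ℝ) / 2) / 2 ≠ 0 := by positivity
  refine mul_right_cancel₀ this ?_
  linear_combination kj - (ascPochhammer ℝ j).eval (1 / 2) * k0

lemma integral_sphereUniform_inner_pow_odd (e : E) {n : ℕ} (hn : Odd n) :
    ∫ θ, inner ℝ e θ ^ n ∂(sphereUniform E) = 0 := by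
  have h := (measurePreserving_sphereUniform (LinearIsometryEquiv.neg ℝ (E := E))).integral_comp
    (Homeomorph.measurableEmbedding (LinearIsometryEquiv.neg ℝ (E := E)).toHomeomorph)
    (fun θ => inner ℝ e θ ^ n)
  simp only [LinearIsometryEquiv.coe_neg, inner_neg_right, hn.neg_pow, integral_neg] at h
  linarith

end

/-! ### Hypergeometric series that are powers of `1 - z` -/

open PowerSeries in
-- Equal logarithmic derivatives: `A * B⁻¹` has zero derivative and constant term `1`.
lemma PowerSeries.eq_of_derivative_mul_eq {A B : PowerSeries ℝ} (hA : constantCoeff A = 1)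
    (hB : constantCoeff B = 1) (h : derivative ℝ A * B = A * derivative ℝ B) : A = B := by
  have hB0 : constantCoeff B ≠ 0 := by rw [hB]; exact one_ne_zero
  have hBB : B * B⁻¹ = 1 := PowerSeries.mul_inv_cancel B hB0
  have key : A * B⁻¹ = 1 := by
    apply derivative.ext
    · rw [Derivation.leibniz, derivative_inv', derivative_one, smul_eq_mul, smul_eq_mul]
      linear_combination (B⁻¹ ^ 2) * h - (derivative ℝ A * B⁻¹) * hBB
    · simp [hA, hB, PowerSeries.constantCoeff_inv]
  calc A = A * (B * B⁻¹) := by rw [hBB, mul_one]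
    _ = (A * B⁻¹) * B := by ring
    _ = B := by rw [key, one_mul]

/-- The power series of `₂F₁(q / 2, (q + 1) / 2; c; z)`. -/
def gaussSeries (q c : ℝ) : PowerSeries ℝ :=
  .mk fun j => (ascPochhammer ℝ (2 * j)).eval q / (4 ^ j * j.factorial * (ascPochhammer ℝ j).eval c)

lemma coeff_gaussSeries (q c : ℝ) (j : ℕ) : PowerSeries.coeff j (gaussSeries q c) =
    (ascPochhammer ℝ (2 * j)).eval q / (4 ^ j * j.factorial * (ascPochhammer ℝ j).eval c) := by
  simp [gaussSeries]

lemma constantCoeff_gaussSeries (q c : ℝ) :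
    PowerSeries.constantCoeff (gaussSeries q c) = 1 := by
  rw [← PowerSeries.coeff_zero_eq_constantCoeff_apply, coeff_gaussSeries]; simp

lemma coeff_succ_gaussSeries (q : ℝ) {c : ℝ} (hc : 0 < c) (j : ℕ) :
    4 * (j + 1) * (c + j) * PowerSeries.coeff (j + 1) (gaussSeries q c) =
      (q + 2 * j) * (q + 2 * j + 1) * PowerSeries.coeff j (gaussSeries q c) := by
  have h := (ascPochhammer_pos j c hc).ne'
  have h' : c + j ≠ 0 := by positivity
  rw [coeff_gaussSeries, coeff_gaussSeries, show 2 * (j + 1) = 2 * j + 1 + 1 by ring, ascPochhammer_succ_eval,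
    ascPochhammer_succ_eval, ascPochhammer_succ_eval, Nat.factorial_succ]
  push_cast
  field_simp
  ring

/-- `A` is the power series of `(1 - z) ^ (-s)`. -/
structure IsNegBinomialSeries (s : ℝ) (A : PowerSeries ℝ) : Prop where
  constantCoeff : PowerSeries.constantCoeff A = 1
  derivative : (1 - PowerSeries.X) * PowerSeries.derivative ℝ A = s • A

namespace IsNegBinomialSeries

variable {s r : ℝ} {A B : PowerSeries ℝ}

lemma mul (hA : IsNegBinomialSeries s A) (hB : IsNegBinomialSeries r B) :
    IsNegBinomialSeries (s + r) (A * B) where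
  constantCoeff := by rw [map_mul, hA.constantCoeff, hB.constantCoeff, mul_one]
  derivative := by
    have h1 := hA.derivative
    have h2 := hB.derivative
    rw [PowerSeries.smul_eq_C_mul] at *
    rw [Derivation.leibniz, smul_eq_mul, smul_eq_mul, map_add]
    linear_combination A * h2 + B * h1

lemma pow (hA : IsNegBinomialSeries s A) (n : ℕ) : IsNegBinomialSeries (n * s) (A ^ n) := by
  induction n with
  | zero => exact ⟨by simp, by simp⟩
  | succ n ih => rw [pow_succ, Nat.cast_succ, add_one_mul]; exact ih.mul hA

lemma eq (hA : IsNegBinomialSeries s A) (hB : IsNegBinomialSeries s B) : A = B := by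
  refine PowerSeries.eq_of_derivative_mul_eq hA.constantCoeff hB.constantCoeff ?_
  have h1 := hA.derivative
  have h2 := hB.derivative
  rw [PowerSeries.smul_eq_C_mul] at *
  have h3 : (1 - PowerSeries.X : PowerSeries ℝ) ≠ 0 := fun h => by
    simpa using congrArg PowerSeries.constantCoeff h
  refine mul_left_cancel₀ h3 ?_
  linear_combination B * h1 - A * h2

lemma of_coeff (h0 : PowerSeries.constantCoeff A = 1)
    (h : ∀ j : ℕ, (j + 1) * PowerSeries.coeff (j + 1) A = (s + j) * PowerSeries.coeff j A) :
    IsNegBinomialSeries s A where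
  constantCoeff := h0
  derivative := by
    ext j
    rw [sub_mul, one_mul, map_sub, PowerSeries.coeff_derivative, PowerSeries.coeff_smul,
      smul_eq_mul]
    rcases j with _ | j
    · have := h 0
      simp at this ⊢
      linarith
    · have := h (j + 1)
      rw [PowerSeries.coeff_succ_X_mul, PowerSeries.coeff_derivative]
      push_cast at this ⊢
      linarith

/-- For `c = (q + 1) / 2` the factor `q + 2j + 1` of the coefficient recurrence cancels against `2(c
+ j)`, leaving a binomial recurrence. For `c = q / 2` below, the factor `q + 2j` cancels instead. -/
lemma gaussSeries_add_one_div_two {q : ℝ} (hq : 0 < q) :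
    IsNegBinomialSeries (q / 2) (gaussSeries q ((q + 1) / 2)) := by
  refine of_coeff (constantCoeff_gaussSeries _ _) fun j => ?_
  have h := coeff_succ_gaussSeries q (c := (q + 1) / 2) (by positivity) j
  have h' : q + 2 * j + 1 ≠ 0 := by positivity
  refine mul_left_cancel₀ h' ?_
  linear_combination h / 2

lemma gaussSeries_div_two {q : ℝ} (hq : 0 < q) :
    IsNegBinomialSeries ((q + 1) / 2) (gaussSeries q (q / 2)) := by
  refine of_coeff (constantCoeff_gaussSeries _ _) fun j => ?_
  have h := coeff_succ_gaussSeries q (c := q / 2) (by positivity) j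
  have h' : q + 2 * j ≠ 0 := by positivity
  refine mul_left_cancel₀ h' ?_
  linear_combination h / 2

end IsNegBinomialSeries

/-! ### Hypergeometric series that are powers of `2 / (1 + √(1 - z))` -/

section Catalan

open PowerSeries

variable {s r : ℝ}

/-- Write `G_s` for `gaussSeries s (s + 1)` and `H_s` for `gaussSeries (s + 1) (s + 1)`. The
relation comes from `(s + 2j) (s)_{2j} = s (s + 1)_{2j}`; with the next lemma it forms a closed
first-order system for `G_s` and `H_s`. -/
lemma X_mul_derivative_gaussSeries (s : ℝ) :
    X * derivative ℝ (gaussSeries s (s + 1)) =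
      C (s / 2) * (gaussSeries (s + 1) (s + 1) - gaussSeries s (s + 1)) := by
  ext j
  have h : (s + 2 * j) * coeff j (gaussSeries s (s + 1)) =
      s * coeff j (gaussSeries (s + 1) (s + 1)) := by
    have e := ascPochhammer_succ_eval (2 * j) s
    rw [ascPochhammer_succ_left, Polynomial.eval_mul, Polynomial.eval_X, Polynomial.eval_comp,
      Polynomial.eval_add, Polynomial.eval_X, Polynomial.eval_one] at e
    push_cast at e
    rw [coeff_gaussSeries, coeff_gaussSeries, ← mul_div_assoc, ← mul_div_assoc, e]
    ring
  rw [coeff_C_mul, map_sub]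
  rcases j with _ | j
  · simp at h ⊢
    rw [constantCoeff_gaussSeries, constantCoeff_gaussSeries]; simp
  · rw [coeff_succ_X_mul, coeff_derivative]
    push_cast at h
    linear_combination h / 2

lemma one_sub_X_mul_X_mul_derivative_gaussSeries (hs : 0 < s) :
    (1 - X) * (X * derivative ℝ (gaussSeries (s + 1) (s + 1))) =
      C (s / 2) * (gaussSeries s (s + 1) - (1 - X) * gaussSeries (s + 1) (s + 1)) +
        C (1 / 2) * (X * gaussSeries (s + 1) (s + 1)) := by
  ext j
  rcases j with _ | j
  · simp [constantCoeff_gaussSeries]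
  have h1 := congrArg (coeff (j + 1)) (X_mul_derivative_gaussSeries s)
  have h2 := coeff_succ_gaussSeries (s + 1) (c := s + 1) (by positivity) j
  have hX : coeff (j + 1) (X * (X * derivative ℝ (gaussSeries (s + 1) (s + 1)))) =
      j * coeff j (gaussSeries (s + 1) (s + 1)) := by
    rw [coeff_succ_X_mul]
    rcases j with _ | j
    · simp
    · rw [coeff_succ_X_mul, coeff_derivative]; push_cast; ring
  rw [coeff_succ_X_mul, coeff_derivative, coeff_C_mul, map_sub] at h1
  rw [sub_mul, sub_mul, one_mul, one_mul, map_sub, hX, map_add, coeff_C_mul, coeff_C_mul, map_sub,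
    map_sub, coeff_succ_X_mul, coeff_succ_X_mul, coeff_derivative]
  set g := coeff (j + 1) (gaussSeries s (s + 1))
  set h := coeff (j + 1) (gaussSeries (s + 1) (s + 1))
  set k := coeff j (gaussSeries (s + 1) (s + 1))
  -- `h1` amounts to `(s + 2j + 2) g = s h`, so multiplying by this factor eliminates `g`.
  have h' : s + 2 * j + 2 ≠ 0 := by positivity
  refine mul_left_cancel₀ h' ?_
  linear_combination -s * h1 + h2 / 2

/-- By the first-order system, the difference `D` of the two sides satisfies `z D' = -s D`. Its
coefficients satisfy `(s + j) D_j = 0`, hence vanish since `s > 0`. -/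
lemma one_sub_X_mul_gaussSeries_sq (hs : 0 < s) :
    (1 - X) * gaussSeries (s + 1) (s + 1) ^ 2 = gaussSeries s (s + 1) ^ 2 := by
  have h1 := X_mul_derivative_gaussSeries s
  have h2 := one_sub_X_mul_X_mul_derivative_gaussSeries hs
  set G := gaussSeries s (s + 1)
  set H := gaussSeries (s + 1) (s + 1)
  rw [← sub_eq_zero]
  have hD : X * derivative ℝ ((1 - X) * H ^ 2 - G ^ 2) = -(C s * ((1 - X) * H ^ 2 - G ^ 2)) := by
    have e1 : (C (s / 2) : PowerSeries ℝ) * 2 = C s := by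
      rw [← map_ofNat C 2, ← map_mul]; congr 1; ring
    have e2 : (C (1 / 2) : PowerSeries ℝ) * 2 = 1 := by
      rw [← map_ofNat C 2, ← map_mul, ← map_one C]; congr 1; norm_num
    have : derivative ℝ ((1 - X) * H ^ 2 - G ^ 2) =
        -H ^ 2 + (1 - X) * (2 * H * derivative ℝ H) - 2 * G * derivative ℝ G := by
      simp only [map_sub, Derivation.leibniz, derivative_one, derivative_X, smul_eq_mul, sq]
      ring
    rw [this]
    linear_combination 2 * H * h2 - 2 * G * h1 + (-H * (1 - X) * H + G ^ 2) * e1 + X * H ^ 2 * e2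
  ext j
  have := congrArg (coeff j) hD
  rw [map_neg, coeff_C_mul] at this
  rw [map_zero]
  rcases j with _ | j
  · simpa [hs.ne'] using this.symm
  · rw [coeff_succ_X_mul, coeff_derivative] at this
    have h' : s + (j + 1) ≠ 0 := by positivity
    refine (mul_eq_zero.1 (?_ : (s + (j + 1)) * _ = 0)).resolve_left h'
    linear_combination this

/-- The ratio `H_s / G_s = (1 - z) ^ (-1/2)` does not depend on `s`. The previous lemma gives this
up to sign, and constant terms fix the sign. -/
lemma gaussSeries_mul_comm (hs : 0 < s) (hr : 0 < r) :
    gaussSeries s (s + 1) * gaussSeries (r + 1) (r + 1) =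
      gaussSeries r (r + 1) * gaussSeries (s + 1) (s + 1) := by
  have h1 := one_sub_X_mul_gaussSeries_sq hs
  have h2 := one_sub_X_mul_gaussSeries_sq hr
  have h : (gaussSeries s (s + 1) * gaussSeries (r + 1) (r + 1)) ^ 2 =
      (gaussSeries r (r + 1) * gaussSeries (s + 1) (s + 1)) ^ 2 := by
    linear_combination gaussSeries (s + 1) (s + 1) ^ 2 * h2 -
      gaussSeries (r + 1) (r + 1) ^ 2 * h1
  refine (sq_eq_sq_iff_eq_or_eq_neg.1 h).resolve_right fun h => ?_
  have := congrArg constantCoeff h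
  simp only [map_mul, map_neg, constantCoeff_gaussSeries] at this
  norm_num at this

/-- Here `z G_s' / G_s = (s / 2) (H_s / G_s - 1)`. As `H_s / G_s` is independent of `s`, the
logarithmic derivative of `G_s` is linear in `s`. -/
lemma gaussSeries_mul_gaussSeries (hs : 0 < s) (hr : 0 < r) :
    gaussSeries s (s + 1) * gaussSeries r (r + 1) = gaussSeries (s + r) (s + r + 1) := by
  refine PowerSeries.eq_of_derivative_mul_eq (by simp [constantCoeff_gaussSeries])
    (constantCoeff_gaussSeries _ _) (mul_left_cancel₀ (X_ne_zero (R := ℝ)) ?_)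
  have h1 := X_mul_derivative_gaussSeries s
  have h2 := X_mul_derivative_gaussSeries r
  have h3 := X_mul_derivative_gaussSeries (s + r)
  have h4 := gaussSeries_mul_comm hs hr
  have h5 := gaussSeries_mul_comm hs (add_pos hs hr)
  have e : (C ((s + r) / 2) : PowerSeries ℝ) = C (s / 2) + C (r / 2) := by rw [add_div, map_add]
  rw [e] at h3
  rw [Derivation.leibniz, smul_eq_mul, smul_eq_mul]
  set Gs := gaussSeries s (s + 1)
  set Gr := gaussSeries r (r + 1)
  set G := gaussSeries (s + r) (s + r + 1)
  set Hs := gaussSeries (s + 1) (s + 1)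
  linear_combination Gr * G * h1 + Gs * G * h2 - Gs * Gr * h3 + C (r / 2) * G * h4 -
    (C (s / 2) + C (r / 2)) * Gr * h5

lemma gaussSeries_mul_gaussSeries_add_one (hs : 0 < s) (hr : 0 < r) :
    gaussSeries s (s + 1) * gaussSeries (r + 1) (r + 1) =
      gaussSeries (s + r + 1) (s + r + 1) := by
  have h0 : gaussSeries r (r + 1) ≠ 0 := fun h => by
    simpa [constantCoeff_gaussSeries] using congrArg constantCoeff h
  refine mul_left_cancel₀ h0 ?_
  have h1 := gaussSeries_mul_gaussSeries hs hr
  have h2 := gaussSeries_mul_comm hr (add_pos hs hr)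
  linear_combination gaussSeries (r + 1) (r + 1) * h1 - h2

lemma gaussSeries_pow_succ (hs : 0 < s) (n : ℕ) :
    gaussSeries s (s + 1) ^ (n + 1) = gaussSeries ((n + 1) * s) ((n + 1) * s + 1) := by
  induction n with
  | zero => simp
  | succ n ih =>
    rw [pow_succ, ih, gaussSeries_mul_gaussSeries (by positivity) hs]
    push_cast
    ring_nf

end Catalan

/-! ### The product identities for the two families of parameters -/

lemma Fin.prod_ite_eq_pow_mul {M : Type*} [CommMonoid M] {N : ℕ} (i₀ : Fin (N + 1)) (a b : M) :
    ∏ i, (if i = i₀ then a else b) = b ^ N * a := by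
  rw [Fin.prod_univ_succAbove _ i₀, mul_comm]
  simp [Fin.succAbove_ne]

lemma prod_gaussSeries_add_one_div_two {N : ℕ} (i₀ : Fin (N + 1)) {q m : ℝ} (hq : 0 < q)
    (hm : m = 0 ∨ m = 1) :
    ∏ i, gaussSeries (if i = i₀ then q + m else q) ((q + 1) / 2) =
      gaussSeries ((N + 1) * q + m) (((N + 1) * q + 1) / 2) := by
  simp_rw [apply_ite (fun x => gaussSeries x ((q + 1) / 2))]
  rw [Fin.prod_ite_eq_pow_mul]
  have hB := (IsNegBinomialSeries.gaussSeries_add_one_div_two hq).pow N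
  rcases hm with rfl | rfl
  · have h1 := hB.mul (IsNegBinomialSeries.gaussSeries_add_one_div_two hq)
    have h2 := IsNegBinomialSeries.gaussSeries_add_one_div_two (q := (N + 1) * q) (by positivity)
    simp only [add_zero]
    exact h1.eq (by convert! h2 using 1; ring)
  · have h1 := hB.mul (IsNegBinomialSeries.gaussSeries_div_two (q := q + 1) (by positivity))
    have h2 := IsNegBinomialSeries.gaussSeries_div_two (q := (N + 1) * q + 1) (by positivity)
    exact h1.eq (by convert! h2 using 1; ring)

lemma prod_gaussSeries_add_one {N : ℕ} (i₀ : Fin (N + 1)) {q m : ℝ} (hq : 0 < q)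
    (hm : m = 0 ∨ m = 1) :
    ∏ i, gaussSeries (if i = i₀ then q + m else q) (q + 1) =
      gaussSeries ((N + 1) * q + m) ((N + 1) * q + 1) := by
  simp_rw [apply_ite (fun x => gaussSeries x (q + 1))]
  rw [Fin.prod_ite_eq_pow_mul]
  rcases hm with rfl | rfl
  · simp only [add_zero]
    rw [← pow_succ, gaussSeries_pow_succ hq]
  -- With `N = 0` there is no factor of parameter `q`, so the power formula, which needs a positive
  -- exponent, does not apply.
  · rcases N with _ | N
    · simp
    · rw [gaussSeries_pow_succ hq, gaussSeries_mul_gaussSeries_add_one (by positivity) hq]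
      push_cast
      ring_nf

/-- A finite measure carried by the unit interval is determined by its moments. -/
lemma MeasureTheory.Measure.ext_of_integral_pow_eq {μ ν : Measure ℝ} [IsFiniteMeasure μ]
    [IsFiniteMeasure ν] (hμ : ∀ᵐ x ∂μ, x ∈ Set.Icc (0 : ℝ) 1) (hν : ∀ᵐ x ∂ν, x ∈ Set.Icc (0 : ℝ) 1)
    (h : ∀ j : ℕ, ∫ x, x ^ j ∂μ = ∫ x, x ^ j ∂ν) : μ = ν := by
  have hint : ∀ (ρ : Measure ℝ) [IsFiniteMeasure ρ], (∀ᵐ x ∂ρ, x ∈ Set.Icc (0 : ℝ) 1) →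
      ∀ p : Polynomial ℝ, Integrable (fun x => p.eval x) ρ := by
    intro ρ _ hρ p
    obtain ⟨C, hC⟩ := (isCompact_Icc (a := (0 : ℝ)) (b := 1)).exists_bound_of_continuousOn
      p.continuous.continuousOn
    exact Integrable.of_bound p.continuous.aestronglyMeasurable C (hρ.mono fun x hx => hC x hx)
  have hpoly : ∀ p : Polynomial ℝ, ∫ x, p.eval x ∂μ = ∫ x, p.eval x ∂ν := by
    intro p
    simp_rw [Polynomial.eval_eq_sum_range]
    have hi : ∀ (ρ : Measure ℝ) [IsFiniteMeasure ρ], (∀ᵐ x ∂ρ, x ∈ Set.Icc (0 : ℝ) 1) →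
        ∀ i ∈ Finset.range (p.natDegree + 1), Integrable (fun x => p.coeff i * x ^ i) ρ := by
      intro ρ _ hρ i _
      exact (hint ρ hρ (Polynomial.C (p.coeff i) * Polynomial.X ^ i)).congr
        (.of_forall fun x => by simp)
    rw [integral_finsetSum _ (hi μ hμ), integral_finsetSum _ (hi ν hν)]
    simp_rw [integral_const_mul, h]
  refine ext_of_forall_integral_eq_of_IsFiniteMeasure fun f => ?_
  have hclose : ∀ (ρ : Measure ℝ) [IsFiniteMeasure ρ], (∀ᵐ x ∂ρ, x ∈ Set.Icc (0 : ℝ) 1) →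
      ∀ (p : Polynomial ℝ) (ε : ℝ), (∀ x ∈ Set.Icc (0 : ℝ) 1, |p.eval x - f x| < ε) →
      |∫ x, p.eval x ∂ρ - ∫ x, f x ∂ρ| ≤ ε * ρ.real Set.univ := by
    intro ρ _ hρ p ε hp
    rw [← integral_sub (hint ρ hρ p) (f.integrable ρ)]
    exact norm_integral_le_of_norm_le_const (f := fun x => p.eval x - f x) (hρ.mono fun x hx => (hp x hx).le)
  refine eq_of_forall_dist_le fun ε hε => ?_
  -- The summand `1` keeps `c` positive even when both measures are zero.
  set c := μ.real Set.univ + ν.real Set.univ + 1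
  have hc : 0 < c := by positivity
  obtain ⟨p, hp⟩ := exists_polynomial_near_of_continuousOn 0 1 f f.continuous.continuousOn (ε / c)
    (by positivity)
  have h1 := abs_le.1 (hclose μ hμ p _ hp)
  have h2 := abs_le.1 (hclose ν hν p _ hp)
  rw [hpoly p] at h1
  have h3 : ε / c * c = ε := by field_simp
  have h4 : 0 < ε / c := by positivity
  rw [Real.dist_eq, abs_le]
  constructor <;> nlinarith

lemma measurable_betaPDF (a b : ℝ) : Measurable (betaPDF a b) :=
  (measurable_betaPDFReal a b).ennreal_ofReal

/-- Multiplying the `β(a, b)` density by `x ^ j` gives a multiple of the `β(a + j, b)` density,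
whose integral is `1`. -/
lemma integral_betaMeasure_pow {a b : ℝ} (ha : 0 < a) (hb : 0 < b) (j : ℕ) :
    ∫ x, x ^ j ∂(betaMeasure a b) =
      (ascPochhammer ℝ j).eval a / (ascPochhammer ℝ j).eval (a + b) := by
  have haj : 0 < a + j := by positivity
  have h : ∀ x, betaPDFReal a b x * x ^ j =
      beta (a + j) b / beta a b * betaPDFReal (a + j) b x := by
    intro x
    have := (beta_pos haj hb).ne'
    have := (beta_pos ha hb).ne'
    unfold betaPDFReal
    split_ifs with hx
    · rw [show a + j - 1 = (a - 1) + j by ring, Real.rpow_add hx.1, Real.rpow_natCast]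
      field_simp
    · simp
  have hnn : ∀ {a : ℝ}, 0 < a → ∀ x, 0 ≤ betaPDFReal a b x := by
    intro a ha x
    by_cases hx : 0 < x ∧ x < 1
    · exact (betaPDFReal_pos hx.1 hx.2 ha hb).le
    · simp [betaPDFReal, hx]
  have h1 : ∫ x, betaPDFReal (a + j) b x = 1 := by
    rw [integral_eq_lintegral_of_nonneg_ae (.of_forall (hnn haj))
      (measurable_betaPDFReal _ _).aestronglyMeasurable]
    have := lintegral_betaPDF_eq_one haj hb
    simp only [betaPDF] at this
    rw [this, ENNReal.toReal_one]
  rw [betaMeasure, integral_withDensity_eq_integral_toReal_smul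
    (measurable_betaPDF a b) (.of_forall fun x => ENNReal.ofReal_lt_top)]
  simp only [betaPDF, ENNReal.toReal_ofReal (hnn ha _), smul_eq_mul, h]
  rw [integral_const_mul, h1, mul_one, beta, beta, Real.Gamma_add_natCast_eq ha,
    show a + j + b = a + b + j by ring, Real.Gamma_add_natCast_eq (by positivity)]
  have := (Real.Gamma_pos_of_pos ha).ne'
  have := (Real.Gamma_pos_of_pos hb).ne'
  have := (Real.Gamma_pos_of_pos (add_pos ha hb)).ne'
  have := (ascPochhammer_pos j _ (add_pos ha hb)).ne'
  field_simp

lemma ae_betaMeasure_mem_Icc (a b : ℝ) : ∀ᵐ x ∂(betaMeasure a b), x ∈ Set.Icc (0 : ℝ) 1 := by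
  rw [betaMeasure, ae_withDensity_iff (measurable_betaPDF a b)]
  refine .of_forall fun x hx => ⟨?_, ?_⟩
  · by_contra! h
    exact hx (betaPDF_eq_zero_of_nonpos h.le)
  · by_contra! h
    exact hx (betaPDF_eq_zero_of_one_le h.le)

lemma factorial_two_mul_eq (j : ℕ) :
    ((2 * j).factorial : ℝ) = 4 ^ j * j.factorial * (ascPochhammer ℝ j).eval (1 / 2) := by
  induction j with
  | zero => simp
  | succ j ih =>
    rw [show 2 * (j + 1) = 2 * j + 1 + 1 by ring, Nat.factorial_succ, Nat.factorial_succ,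
      Nat.factorial_succ, ascPochhammer_succ_eval]
    push_cast
    rw [ih]
    ring

lemma PowerSeries.coeff_prod_eq_sum_piAntidiag {ι : Type*} [Fintype ι] [DecidableEq ι]
    (f : ι → PowerSeries ℝ) (n : ℕ) : PowerSeries.coeff n (∏ i, f i) =
      ∑ β ∈ Finset.univ.piAntidiag n, ∏ i, PowerSeries.coeff (β i) (f i) := by
  rw [PowerSeries.coeff_prod]
  refine Finset.sum_nbij' (fun l i => l i) (fun β => Finsupp.equivFunOnFinite.symm β) ?_ ?_ ?_ ?_ ?_
  · intro l hl; simpa using hl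
  · intro β hβ; simpa using hβ
  · intro l _; ext; simp
  · intro β _; ext; simp
  · intro l _; rfl

/-! ### Moments of the projections and of the norm -/

section

variable {E : Type*} [NormedAddCommGroup E] [InnerProductSpace ℝ E] [FiniteDimensional ℝ E]
  [MeasurableSpace E] [BorelSpace E]

lemma integrable_sphereUniform_inner_pow [Nontrivial E] {e : E} (he : ‖e‖ = 1) (n : ℕ) :
    Integrable (fun θ => inner ℝ e θ ^ n) (sphereUniform E) := by
  have := isProbabilityMeasure_sphereUniform (E := E)
  refine Integrable.of_bound (Measurable.aestronglyMeasurable (by fun_prop)) 1 ?_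
  filter_upwards [ae_sphereUniform_norm_eq_one] with θ hθ
  rw [norm_pow]
  refine pow_le_one₀ (norm_nonneg _) ?_
  simpa [he, hθ] using norm_inner_le_norm (𝕜 := ℝ) e θ

lemma integrable_dirichletMeasure_prod_pow {N : ℕ} {q : Fin (N + 1) → ℝ} (hq : ∀ i, 0 < q i)
    (α : Fin (N + 1) → ℕ) : Integrable (fun x => ∏ i, x i ^ α i) (dirichletMeasure q) := by
  have := isProbabilityMeasure_dirichletMeasure hq
  refine Integrable.of_bound (Measurable.aestronglyMeasurable (by fun_prop)) 1 ?_
  filter_upwards [ae_dirichletMeasure q] with x hx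
  rw [norm_prod]
  refine Finset.prod_le_one (fun i _ => norm_nonneg _) fun i _ => ?_
  rw [norm_pow, Real.norm_of_nonneg (hx.1 i).le]
  refine pow_le_one₀ (hx.1 i).le ?_
  rw [← hx.2]
  exact Finset.single_le_sum (f := x) (fun i _ => (hx.1 i).le) (Finset.mem_univ i)

/-- The law of the pair formed by a Dirichlet vector and independent uniform unit vectors. -/
def dirichletWalkMeasure (E : Type*) [NormedAddCommGroup E] [InnerProductSpace ℝ E]
    [FiniteDimensional ℝ E] [MeasurableSpace E] [BorelSpace E] {n : ℕ} (q : Fin n → ℝ) :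
    Measure ((Fin n → ℝ) × (Fin n → E)) :=
  (dirichletMeasure q).prod (Measure.pi fun _ => sphereUniform E)

lemma measurable_sum_smul (n : ℕ) :
    Measurable fun p : (Fin n → ℝ) × (Fin n → E) => ∑ j, p.1 j • p.2 j := by
  fun_prop

/-- The multinomial coefficient contributes `(2j)! / ∏ (αᵢ)!`, so each term factors over `i` and the
sum becomes a Cauchy product coefficient. -/
lemma integral_dirichletWalkMeasure_inner_pow [Nontrivial E] {N : ℕ} {q : Fin (N + 1) → ℝ}
    (hq : ∀ i, 0 < q i) {e : E} (he : ‖e‖ = 1) (j : ℕ) :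
    ∫ p, inner ℝ e (∑ i, p.1 i • p.2 i) ^ (2 * j) ∂(dirichletWalkMeasure E q) =
      (2 * j).factorial / (ascPochhammer ℝ (2 * j)).eval (∑ i, q i) *
        PowerSeries.coeff j (∏ i, gaussSeries (q i) ((Module.finrank ℝ E : ℝ) / 2)) := by
  have := isProbabilityMeasure_dirichletMeasure hq
  have := isProbabilityMeasure_sphereUniform (E := E)
  have hexp : ∀ p : (Fin (N + 1) → ℝ) × (Fin (N + 1) → E),
      inner ℝ e (∑ i, p.1 i • p.2 i) ^ (2 * j) =
        ∑ α ∈ Finset.univ.piAntidiag (2 * j), (Nat.multinomial Finset.univ α : ℝ) *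
          ((∏ i, p.1 i ^ α i) * ∏ i, inner ℝ e (p.2 i) ^ α i) := by
    intro p
    simp_rw [inner_sum, inner_smul_right]
    rw [Finset.sum_pow_eq_sum_piAntidiag]
    simp_rw [mul_pow, Finset.prod_mul_distrib]
  simp_rw [hexp]
  rw [integral_finsetSum]
  swap
  · intro α _
    refine Integrable.const_mul ?_ _
    exact (integrable_dirichletMeasure_prod_pow hq α).mul_prod
      (Integrable.fintype_prod (f := fun i (θ : E) => inner ℝ e θ ^ α i)
        fun i => integrable_sphereUniform_inner_pow he (α i))
  have hterm : ∀ α ∈ Finset.univ.piAntidiag (2 * j),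
      ∫ p, (Nat.multinomial Finset.univ α : ℝ) *
        ((∏ i, p.1 i ^ α i) * ∏ i, inner ℝ e (p.2 i) ^ α i) ∂(dirichletWalkMeasure E q) =
      (2 * j).factorial / (ascPochhammer ℝ (2 * j)).eval (∑ i, q i) *
        ∏ i, ((ascPochhammer ℝ (α i)).eval (q i) / (α i).factorial *
          ∫ θ, inner ℝ e θ ^ α i ∂(sphereUniform E)) := by
    intro α hα
    have hsum : ∑ i, α i = 2 * j := (Finset.mem_piAntidiag.1 hα).1
    rw [integral_const_mul, dirichletWalkMeasure,
      integral_prod_mul (fun x : Fin (N + 1) → ℝ => ∏ i, x i ^ α i)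
        (fun θ : Fin (N + 1) → E => ∏ i, inner ℝ e (θ i) ^ α i),
      integral_dirichletMeasure_prod_pow hq, hsum,
      integral_fintype_prod_eq_prod (fun i (θ : E) => inner ℝ e θ ^ α i),
      Finset.prod_mul_distrib, Finset.prod_div_distrib]
    have hmul : (∏ i, ((α i).factorial : ℝ)) * Nat.multinomial Finset.univ α =
        (2 * j).factorial := by
      rw [← hsum, ← Nat.multinomial_spec Finset.univ α]
      push_cast
      rfl
    have hf : (∏ i, ((α i).factorial : ℝ)) ≠ 0 :=
      Finset.prod_ne_zero_iff.2 fun i _ => by positivity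
    rw [← hmul]
    field_simp
  rw [Finset.sum_congr rfl hterm, ← Finset.mul_sum, PowerSeries.coeff_prod_eq_sum_piAntidiag]
  congr 1
  -- Odd exponents give zero, so only `α = 2β` with `∑ β i = j` remains.
  have heven : ({α ∈ Finset.univ.piAntidiag (2 * j) | ∀ i, 2 ∣ α i} : Finset (Fin (N + 1) → ℕ)) =
      (Finset.univ.piAntidiag j).map ⟨(2 • ·), nsmul_right_injective two_ne_zero⟩ := by
    rw [Finset.map_nsmul_piAntidiag_univ j two_ne_zero]
    ext α
    simp only [Finset.mem_filter]
  rw [← Finset.sum_filter_of_ne (p := fun α : Fin (N + 1) → ℕ => ∀ i, 2 ∣ α i), heven,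
    Finset.sum_map]
  · refine Finset.sum_congr rfl fun β _ => Finset.prod_congr rfl fun i _ => ?_
    simp only [Function.Embedding.coeFn_mk, Pi.smul_apply, smul_eq_mul]
    rw [integral_sphereUniform_inner_pow_even he, coeff_gaussSeries, factorial_two_mul_eq]
    have := (ascPochhammer_pos (β i) (1 / 2 : ℝ) (by norm_num)).ne'
    field_simp
  · intro α _ hα i
    by_contra h
    refine hα (Finset.prod_eq_zero (Finset.mem_univ i) ?_)
    rw [integral_sphereUniform_inner_pow_odd e (Nat.not_even_iff_odd.1
      (even_iff_two_dvd.not.2 h)), mul_zero]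

lemma integral_sphereUniform_inner_pow_even_right [Nontrivial E] (w : E) (j : ℕ) :
    ∫ θ, inner ℝ θ w ^ (2 * j) ∂(sphereUniform E) = ‖w‖ ^ (2 * j) *
      ((ascPochhammer ℝ j).eval (1 / 2) /
        (ascPochhammer ℝ j).eval ((Module.finrank ℝ E : ℝ) / 2)) := by
  obtain ⟨e, he, hw⟩ : ∃ e : E, ‖e‖ = 1 ∧ w = ‖w‖ • e := by
    by_cases h : w = 0
    · obtain ⟨e, he⟩ := exists_norm_eq E zero_le_one
      exact ⟨e, he, by simp [h]⟩
    · exact ⟨‖w‖⁻¹ • w, norm_smul_inv_norm h, by simp [h]⟩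
  rw [← integral_sphereUniform_inner_pow_even he j, ← integral_const_mul]
  refine integral_congr_ae (.of_forall fun θ => ?_)
  simp only
  conv_lhs => rw [hw, inner_smul_right, real_inner_comm, mul_pow]

/-- The even moments of the norm are determined by those of the one-dimensional projections. -/
lemma integral_norm_pow_eq_of_integral_inner_pow [Nontrivial E] {ρ : Measure E}
    [IsProbabilityMeasure ρ] (hρ : ∀ᵐ w ∂ρ, ‖w‖ ≤ 1) (j : ℕ) {c : ℝ}
    (h : ∀ e : E, ‖e‖ = 1 → ∫ w, inner ℝ e w ^ (2 * j) ∂ρ =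
      (ascPochhammer ℝ j).eval (1 / 2) * c) :
    ∫ w, ‖w‖ ^ (2 * j) ∂ρ = (ascPochhammer ℝ j).eval ((Module.finrank ℝ E : ℝ) / 2) * c := by
  have := isProbabilityMeasure_sphereUniform (E := E)
  have hd : (0 : ℝ) < (Module.finrank ℝ E : ℝ) / 2 := by
    have : 0 < Module.finrank ℝ E := Module.finrank_pos
    positivity
  have hint : Integrable (Function.uncurry fun θ w : E => inner ℝ θ w ^ (2 * j))
      ((sphereUniform E).prod ρ) := by
    refine Integrable.of_bound (Measurable.aestronglyMeasurable (by fun_prop)) 1 ?_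
    have h1 := Measure.quasiMeasurePreserving_fst (μ := sphereUniform E) (ν := ρ) |>.ae
      ae_sphereUniform_norm_eq_one
    have h2 := Measure.quasiMeasurePreserving_snd (μ := sphereUniform E) (ν := ρ) |>.ae hρ
    filter_upwards [h1, h2] with p hp1 hp2
    rw [Function.uncurry_def, norm_pow]
    refine pow_le_one₀ (norm_nonneg _) ((norm_inner_le_norm _ _).trans ?_)
    rw [hp1, one_mul]
    exact hp2
  -- `⟨θ, w⟩ ^ (2j)` is integrated in both orders: over `θ` first it gives a multiple of `‖w‖ ^
  -- (2j)`, over `w` first the constant supplied by `h`.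
  have hswap := integral_integral_swap hint
  simp_rw [integral_sphereUniform_inner_pow_even_right] at hswap
  rw [integral_mul_const, integral_congr_ae
    (ae_sphereUniform_norm_eq_one.mono fun θ hθ => h θ hθ)] at hswap
  have h1 := (ascPochhammer_pos j _ hd).ne'
  have h2 := (ascPochhammer_pos j (1 / 2 : ℝ) (by norm_num)).ne'
  simp only [integral_const, probReal_univ, smul_eq_mul, one_mul] at hswap
  field_simp at hswap
  linarith

end

/-! ### From the product identity to hyperuniformity -/

section

variable {Ω : Type*} [MeasurableSpace Ω] {P : Measure Ω}
  {E : Type*} [NormedAddCommGroup E] [InnerProductSpace ℝ E] [FiniteDimensional ℝ E]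
  [MeasurableSpace E] [BorelSpace E]

lemma measurePreserving_dirichletWalkMeasure [Nontrivial E] {N : ℕ} {q : Fin (N + 1) → ℝ}
    (hq : ∀ i, 0 < q i) (a : E ≃ₗᵢ[ℝ] E) :
    MeasurePreserving (Prod.map id fun (θ : Fin (N + 1) → E) j => a (θ j))
      (dirichletWalkMeasure E q) (dirichletWalkMeasure E q) := by
  have := isProbabilityMeasure_dirichletMeasure hq
  have := isProbabilityMeasure_sphereUniform (E := E)
  exact (MeasurePreserving.id _).prod
    (measurePreserving_pi _ _ fun _ => measurePreserving_sphereUniform a)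

lemma ae_norm_sum_smul_le_one [Nontrivial E] {N : ℕ} {q : Fin (N + 1) → ℝ} (hq : ∀ i, 0 < q i) :
    ∀ᵐ p ∂(dirichletWalkMeasure E q), ‖∑ j, p.1 j • p.2 j‖ ≤ 1 := by
  have := isProbabilityMeasure_dirichletMeasure hq
  have := isProbabilityMeasure_sphereUniform (E := E)
  have h1 := Measure.quasiMeasurePreserving_fst (μ := dirichletMeasure q)
    (ν := Measure.pi fun _ : Fin (N + 1) => sphereUniform E) |>.ae (ae_dirichletMeasure q)
  have h2 := Measure.quasiMeasurePreserving_snd (μ := dirichletMeasure q)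
    (ν := Measure.pi fun _ : Fin (N + 1) => sphereUniform E) |>.ae
    (ae_all_iff.2 fun i => (measurePreserving_eval (fun _ : Fin (N + 1) => sphereUniform E)
      i).quasiMeasurePreserving.ae ae_sphereUniform_norm_eq_one)
  filter_upwards [h1, h2] with p hp1 hp2
  calc ‖∑ j, p.1 j • p.2 j‖ ≤ ∑ j, ‖p.1 j • p.2 j‖ := norm_sum_le _ _
    _ = ∑ j, p.1 j := Finset.sum_congr rfl fun j _ => by
        rw [norm_smul, hp2 j, mul_one, Real.norm_of_nonneg (hp1.1 j).le]
    _ ≤ 1 := hp1.2.le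

/-- `hprod` is the only place where the parameters matter: it identifies the moments of `‖W‖²` with
those of the required beta law. -/
lemma isHyperuniform_randomWalk [IsProbabilityMeasure P] [Nontrivial E] {N : ℕ}
    {q : Fin (N + 1) → ℝ} (hq : ∀ i, 0 < q i) {k : ℝ} (hk : (Module.finrank ℝ E : ℝ) < k)
    (hprod : ∏ i, gaussSeries (q i) ((Module.finrank ℝ E : ℝ) / 2) =
      gaussSeries (∑ i, q i) (k / 2))
    {X : Ω → Fin (N + 1) → ℝ} {Θ : Fin (N + 1) → Ω → E}
    (hX : HasLaw X (dirichletMeasure q) P) (hΘ : ∀ j, HasLaw (Θ j) (sphereUniform E) P)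
    (hΘ_indep : iIndepFun Θ P) (hXΘ_indep : IndepFun X (fun ω j => Θ j ω) P) :
    IsHyperuniform (randomWalk X Θ) k P := by
  have := isProbabilityMeasure_dirichletMeasure hq
  have := isProbabilityMeasure_sphereUniform (E := E)
  have hd : (0 : ℝ) < Module.finrank ℝ E := by exact_mod_cast Module.finrank_pos (R := ℝ) (M := E)
  have hk0 : 0 < k / 2 := by linarith
  set S : (Fin (N + 1) → ℝ) × (Fin (N + 1) → E) → E := fun p => ∑ j, p.1 j • p.2 j with hS
  have hSm : Measurable S := measurable_sum_smul (N + 1)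
  have hlaw : HasLaw (fun ω => (X ω, fun j => Θ j ω)) (dirichletWalkMeasure E q) P :=
    hXΘ_indep.hasLaw_prod hX (hΘ_indep.hasLaw_pi hΘ)
  have : IsProbabilityMeasure (dirichletWalkMeasure E q) := by
    unfold dirichletWalkMeasure; infer_instance
  set ρ := (dirichletWalkMeasure E q).map S with hρ
  have : IsProbabilityMeasure ρ := Measure.isProbabilityMeasure_map hSm.aemeasurable
  have hW : HasLaw (randomWalk X Θ) ρ P :=
    HasLaw.comp (Y := S) (ν := ρ) ⟨hSm.aemeasurable, rfl⟩ hlaw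
  have hnorm : ∀ᵐ w ∂ρ, ‖w‖ ≤ 1 := by
    rw [hρ, ae_map_iff hSm.aemeasurable (measurableSet_le (by fun_prop) measurable_const)]
    exact ae_norm_sum_smul_le_one hq
  have hmom : ∀ j : ℕ, ∫ w, ‖w‖ ^ (2 * j) ∂ρ =
      (ascPochhammer ℝ j).eval ((Module.finrank ℝ E : ℝ) / 2) *
        ((ascPochhammer ℝ j).eval (k / 2))⁻¹ := by
    intro j
    refine integral_norm_pow_eq_of_integral_inner_pow hnorm j fun e he => ?_
    rw [hρ, integral_map hSm.aemeasurable (Measurable.aestronglyMeasurable (by fun_prop)), hS,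
      integral_dirichletWalkMeasure_inner_pow hq he, hprod, coeff_gaussSeries,
      factorial_two_mul_eq]
    have h1 := (ascPochhammer_pos (2 * j) (∑ i, q i)
      (Finset.sum_pos (fun i _ => hq i) Finset.univ_nonempty)).ne'
    have h2 := (ascPochhammer_pos j (k / 2) hk0).ne'
    field_simp
  have hsq : ρ.map (fun w => ‖w‖ ^ 2) =
      betaMeasure ((Module.finrank ℝ E : ℝ) / 2) ((k - Module.finrank ℝ E) / 2) := by
    have hd2 : 0 < (Module.finrank ℝ E : ℝ) / 2 := by linarith
    have hkd : 0 < (k - Module.finrank ℝ E) / 2 := by linarith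
    have := isProbabilityMeasureBeta hd2 hkd
    have : IsProbabilityMeasure (ρ.map (fun w => ‖w‖ ^ 2)) :=
      Measure.isProbabilityMeasure_map (by fun_prop)
    refine Measure.ext_of_integral_pow_eq ?_ (ae_betaMeasure_mem_Icc _ _) fun j => ?_
    · have hm : AEMeasurable (fun w : E => ‖w‖ ^ 2) ρ := by fun_prop
      exact (ae_map_iff hm (measurableSet_Icc (a := (0 : ℝ)) (b := 1))).2
        (hnorm.mono fun w hw => ⟨by positivity, pow_le_one₀ (norm_nonneg _) hw⟩)
    · rw [integral_map (by fun_prop) (Measurable.aestronglyMeasurable (by fun_prop)),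
        integral_betaMeasure_pow hd2 hkd]
      simp_rw [← pow_mul]
      rw [hmom, ← add_div, add_sub_cancel]
      exact (div_eq_mul_inv _ _).symm
  refine ⟨hW.aemeasurable, hk, (hW.ae_iff (by measurability)).2 hnorm, fun a => ?_, ?_⟩
  · refine ⟨a.continuous.measurable.comp_aemeasurable hW.aemeasurable, hW.aemeasurable, ?_⟩
    -- Applying `a` to the sum is applying it to every unit vector, which preserves the joint law.
    have ha := measurePreserving_dirichletWalkMeasure hq a
    rw [hW.map_eq, show (fun ω => a (randomWalk X Θ ω)) = a ∘ randomWalk X Θ from rfl,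
      ← AEMeasurable.map_map_of_aemeasurable a.continuous.measurable.aemeasurable hW.aemeasurable,
      hW.map_eq, hρ, Measure.map_map a.continuous.measurable hSm]
    conv_rhs => rw [← ha.map_eq, Measure.map_map hSm ha.measurable]
    congr 1
    ext p
    simp [hS, map_sum]
  · exact HasLaw.comp (Y := fun w : E => ‖w‖ ^ 2) ⟨by fun_prop, hsq⟩ hW

end

end

theorem theorem6
    {Ω : Type*} [MeasurableSpace Ω] (P : Measure Ω) [IsProbabilityMeasure P]
    {E : Type*} [NormedAddCommGroup E] [InnerProductSpace ℝ E] [FiniteDimensional ℝ E]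
    [MeasurableSpace E] [BorelSpace E]
    (d : ℕ) (hd : Module.finrank ℝ E = d) (n : ℕ) (hn : 2 ≤ n)
    (q m : ℝ) (hm : m = 0 ∨ m = 1) (i₀ : Fin n)
    (X : Ω → Fin n → ℝ) (Θ : Fin n → Ω → E)
    (hX : HasLaw X (dirichletMeasure fun j => if j = i₀ then q + m else q) P)
    (hΘ : ∀ j, HasLaw (Θ j) (sphereUniform E) P)
    (hΘ_indep : iIndepFun Θ P)
    (hXΘ_indep : IndepFun X (fun ω j => Θ j ω) P) :
    (2 ≤ d → q = (d : ℝ) - 1 →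
      IsHyperuniform (randomWalk X Θ) ((n : ℝ) * ((d : ℝ) - 1) + 1) P ∧
      HasLaw (fun ω => ‖randomWalk X Θ ω‖ ^ 2)
        (betaMeasure ((d : ℝ) / 2) (((n : ℝ) - 1) * ((d : ℝ) - 1) / 2)) P) ∧
    (3 ≤ d → q = (d : ℝ) / 2 - 1 →
      IsHyperuniform (randomWalk X Θ) ((n : ℝ) * ((d : ℝ) - 2) + 2) P ∧
      HasLaw (fun ω => ‖randomWalk X Θ ω‖ ^ 2)
        (betaMeasure ((d : ℝ) / 2) (((n : ℝ) - 1) * ((d : ℝ) / 2 - 1))) P) := by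
  obtain ⟨N, rfl⟩ : ∃ N, n = N + 1 := ⟨n - 1, by omega⟩
  have hN : (1 : ℝ) ≤ N := by exact_mod_cast (by omega : 1 ≤ N)
  have hpos : 0 < q → ∀ i, 0 < if i = i₀ then q + m else q := by
    intro hq i
    split_ifs
    · rcases hm with rfl | rfl <;> linarith
    · exact hq
  have hsum : ∑ i, (if i = i₀ then q + m else q) = (N + 1) * q + m := by
    rw [Fin.sum_univ_succAbove _ i₀]
    simp [Fin.succAbove_ne]
    ring
  constructor
  · intro hd2 hq
    have hd2' : (2 : ℝ) ≤ d := by exact_mod_cast hd2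
    have : Nontrivial E := Module.nontrivial_of_finrank_pos (R := ℝ) (by omega)
    have hq0 : 0 < q := by linarith
    have hW : IsHyperuniform (randomWalk X Θ) (((N + 1 : ℕ) : ℝ) * ((d : ℝ) - 1) + 1) P := by
      refine isHyperuniform_randomWalk (hpos hq0) ?_ ?_ hX hΘ hΘ_indep hXΘ_indep
      · rw [hd]; push_cast; nlinarith
      -- Here `d / 2 = (q + 1) / 2`, the case of powers of `1 - z`.
      · rw [hsum, hd, show (d : ℝ) = q + 1 by linarith, prod_gaussSeries_add_one_div_two i₀ hq0 hm]
        push_cast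
        ring_nf
    refine ⟨hW, ?_⟩
    convert! hW.hasLaw_norm_sq using 2
    · rw [hd]
    · rw [hd]; push_cast; ring
  · intro hd3 hq
    have hd3' : (3 : ℝ) ≤ d := by exact_mod_cast hd3
    have : Nontrivial E := Module.nontrivial_of_finrank_pos (R := ℝ) (by omega)
    have hq0 : 0 < q := by linarith
    have hW : IsHyperuniform (randomWalk X Θ) (((N + 1 : ℕ) : ℝ) * ((d : ℝ) - 2) + 2) P := by
      refine isHyperuniform_randomWalk (hpos hq0) ?_ ?_ hX hΘ hΘ_indep hXΘ_indep
      · rw [hd]; push_cast; nlinarith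
      -- Here `d / 2 = q + 1`, the case of powers of `2 / (1 + √(1 - z))`.
      · rw [hsum, hd, show (d : ℝ) = 2 * q + 2 by linarith,
          show (2 * q + 2) / 2 = q + 1 by ring, prod_gaussSeries_add_one i₀ hq0 hm]
        push_cast
        ring_nf
    refine ⟨hW, ?_⟩
    convert! hW.hasLaw_norm_sq using 2
    · rw [hd]
    · rw [hd]; push_cast; ring
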